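/- Let $\mathcal X\subset\mathbb R^{d}$ (contexts) and $\Xi\subset\mathbb R^{d'}$ (outcomes) be finite sets and $\mathcal A$ a finite set of actions. Let $P^0$ be a probability distribution on $\mathcal X$; for each $(x,a)\in\mathcal X\times\mathcal A$ let $R^0_{x,a}$ be a probability distribution on $\Xi$ and $y_{x,a}:\Xi\to[0,Y_{\max}]$ a known cost function; and for each $x\in\mathcal X$ let $\pi_0(\cdot\mid x)$ (the behavior policy) be a probability distribution on $\mathcal A$. Assume there are constants $\mu_{\pi_0},\mu_{x_0}>0$ with $\pi_0(a\mid x)\ge\mu_{\pi_0}$ and $P^0(x)\ge\mu_{x_0}$ for all $x\in\mathcal X$, $a\in\mathcal A$. The data are $n$ independent records $(X_i,A_i,\xi_i)$ with $X_i\sim P^0$, $A_i\sim\pi_0(\cdot\mid X_i)$, $\xi_i\sim R^0_{X_i,A_i}$ (the observed cost being $Y_i=y_{X_i,A_i}(\xi_i)$). For distributions $P,Q$ on a finite set $S$ of points of a Euclidean space let $D(P,Q)=\inf_\sigma \mathbb E_{(s,t)\sim\sigma}\|s-t\|^2$, the infimum being over couplings $\sigma$ of $P$ and $Q$, and let $\mathcal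 U(\epsilon;P)$ be the set of distributions $Q$ on $S$ with $D(P,Q)\le\epsilon$. Fix $\epsilon_x,\epsilon_c>0$. For a policy $\pi$ (a map $x\mapsto\pi(\cdot\mid x)$ from $\mathcal X$ to distributions on $\mathcal A$) the robust value is $$V(\pi)=\sup_{P\in\mathcal U(\epsilon_x;P^0)}\mathbb E_{x\sim P}\,\mathbb E_{a\sim\pi(\cdot\mid x)}\Big[\sup_{R\in\mathcal U(\epsilon_c;R^0_{x,a})}\mathbb E_{\xi\sim R}[y_{x,a}(\xi)]\Big],$$ and the empirical robust value is $$\hat V(\pi)=\inf_{\lambda\ge0}\Big\{\epsilon_x\lambda+\mathbb E_{x\sim\hat P}\Big[\max_{\zeta\in\mathcal X}\big(\mathbb E_{a\sim\pi(\cdot\mid\zeta)}[\hat m(\zeta,a)]-\lambda\|x-\zeta\|^2\big)\Big]\Big\},$$ $$\hat m(x,a)=\inf_{\lambda\ge0}\Big\{\epsilon_c\lambda+\mathbb E_{\xi\sim\hat R_{x,a}}\Big[\max_{\zeta\in\Xi}\big(y_{x,a}(\zeta)-\lambda\|\xi-\zeta\|^2\big)\Big]\Big\},$$ where $\hat P$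 is the empirical distribution of $X_1,\dots,X_n$ and $\hat R_{x,a}$ the empirical distribution of those $\xi_i$ with $(X_i,A_i)=(x,a)$. Let $\Pi$ be any non-empty set of policies, $V^*=\inf_{\pi\in\Pi}V(\pi)$ and $\hat V^*=\inf_{\pi\in\Pi}\hat V(\pi)$ (minima whenever these are attained). Let $\delta\in(0,1)$ and $$n\ge\frac{2\log(4|\mathcal X||\mathcal A|/\delta)}{(\mu_{\pi_0}\mu_{x_0})^2}.$$ Then with probability at least $1-\delta$ every pair $(x,a)\in\mathcal X\times\mathcal A$ occurs in the data (so that $\hat V$ is well defined) and $$|\hat V^*-V^*|\le Y_{\max}\left(\sqrt{\frac{2\log(2/\delta)}{n}}+\sqrt{\frac{|\mathcal X|}{n}}+\sqrt{\frac{4\log(4|\mathcal X||\mathcal A|/\delta)}{n\mu_{\pi_0}\mu_{x_0}}}+\sqrt{\frac{2|\Xi|}{n\mu_{\pi_0}\mu_{x_0}}}\right).$$ -/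

import Mathlib

open MeasureTheory ProbabilityTheory
open scoped NNReal

noncomputable section

namespace WassersteinOPL

/-- Expected transport cost `E_{(x,z) ~ σ} |x - z|^2` of a joint distribution `σ` on `S × S`.
For a finite set of points in Euclidean space, `dist` is the Euclidean distance. -/
def transportCost {S : Type*} [Fintype S] [PseudoMetricSpace S]
    (σ : stdSimplex ℝ (S × S)) : ℝ :=
  ∑ x, ∑ z, σ (x, z) * dist x z ^ 2

/-- `σ` is a coupling of the distributions `P` (first marginal) and `Q` (second marginal). -/
def IsCoupling {S : Type*} [Fintype S] (σ : stdSimplex ℝ (S × S)) (P Q : stdSimplex ℝ S) : Prop :=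
  (∀ x, ∑ z, σ (x, z) = P x) ∧ (∀ z, ∑ x, σ (x, z) = Q z)

/-- The Wasserstein distance (optimal transport cost for the cost `|x - z|^2`). -/
def wassersteinDist {S : Type*} [Fintype S] [PseudoMetricSpace S] (P Q : stdSimplex ℝ S) : ℝ :=
  sInf {c | ∃ σ : stdSimplex ℝ (S × S), IsCoupling σ P Q ∧ c = transportCost σ}

/-- The uncertainty set `U(ε; P)`: all distributions on `S` within Wasserstein distance `ε`
of `P`. -/
def uncertaintySet {S : Type*} [Fintype S] [PseudoMetricSpace S] (ε : ℝ) (P : stdSimplex ℝ S) :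
    Set (stdSimplex ℝ S) :=
  {Q | wassersteinDist P Q ≤ ε}

/-- The worst-case expectation `sup_{Q ∈ U(ε; P)} E_Q[f]`. -/
def worstCaseExpectation {S : Type*} [Fintype S] [PseudoMetricSpace S]
    (ε : ℝ) (P : stdSimplex ℝ S) (f : S → ℝ) : ℝ :=
  ⨆ Q : uncertaintySet ε P, ∑ s, (Q : stdSimplex ℝ S) s * f s

/-- The distributionally robust value `V(π)` of a policy `π`, for the context distribution `P`,
the outcome distributions `R x a` and the cost functions `y x a`:
`sup_{P' ∈ U(εx; P)} E_{x ~ P'} E_{a ~ π(·|x)} sup_{R' ∈ U(εc; R x a)} E_{ξ ~ R'} [y x a ξ]`. -/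
def robustValue {𝒳 𝒜 Ξ : Type*} [Fintype 𝒳] [PseudoMetricSpace 𝒳] [Fintype 𝒜]
    [Fintype Ξ] [PseudoMetricSpace Ξ] (εx εc : ℝ)
    (P : stdSimplex ℝ 𝒳) (R : 𝒳 → 𝒜 → stdSimplex ℝ Ξ) (y : 𝒳 → 𝒜 → Ξ → ℝ)
    (π : 𝒳 → stdSimplex ℝ 𝒜) : ℝ :=
  worstCaseExpectation εx P fun x => ∑ a, π x a * worstCaseExpectation εc (R x a) (y x a)

/-- The dual objective value
`inf_{l ≥ 0} (ε l + E_{x ~ p} [sup_z (f z - l |x - z|^2)])`, for a mass function `p` on `S`. -/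
def dualValue {S : Type*} [Fintype S] [PseudoMetricSpace S]
    (ε : ℝ) (p : S → ℝ) (f : S → ℝ) : ℝ :=
  ⨅ l : ℝ≥0, (ε * (l : ℝ) + ∑ x, p x * ⨆ z, (f z - (l : ℝ) * dist x z ^ 2))

open scoped Classical in
/-- The number of records of the dataset with context `x` and action `a`. -/
def pairCount {𝒳 𝒜 Ξ : Type*} {n : ℕ} (D : Fin n → 𝒳 × 𝒜 × Ξ) (x : 𝒳) (a : 𝒜) : ℕ :=
  (Finset.univ.filter fun i => (D i).1 = x ∧ (D i).2.1 = a).card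

open scoped Classical in
/-- The empirical distribution of the contexts. -/
def empContext {𝒳 𝒜 Ξ : Type*} {n : ℕ} (D : Fin n → 𝒳 × 𝒜 × Ξ) (x : 𝒳) : ℝ :=
  ((Finset.univ.filter fun i => (D i).1 = x).card : ℝ) / n

open scoped Classical in
/-- The empirical distribution of the outcome `ξ` among the records with context `x` and
action `a`. It is identically `0` for a pair that does not occur in the dataset. -/
def empOutcome {𝒳 𝒜 Ξ : Type*} {n : ℕ} (D : Fin n → 𝒳 × 𝒜 × Ξ) (x : 𝒳) (a : 𝒜) (ξ : Ξ) : ℝ :=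
  ((Finset.univ.filter fun i => D i = (x, a, ξ)).card : ℝ) / pairCount D x a

/-- The empirical robust value of the policy `π` computed from the dataset `D`, through the
two-step dual problem. -/
def empRobustValue {𝒳 𝒜 Ξ : Type*} [Fintype 𝒳] [PseudoMetricSpace 𝒳] [Fintype 𝒜]
    [Fintype Ξ] [PseudoMetricSpace Ξ] {n : ℕ} (εx εc : ℝ)
    (D : Fin n → 𝒳 × 𝒜 × Ξ) (y : 𝒳 → 𝒜 → Ξ → ℝ) (π : 𝒳 → stdSimplex ℝ 𝒜) : ℝ :=
  dualValue εx (empContext D) fun x =>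
    ∑ a, π x a * dualValue εc (empOutcome D x a) (y x a)

/-- The records `D i = (X_i, A_i, ξ_i)` are measurable, independent, and each of them is
generated by `X_i ~ P`, `A_i ~ π₀(·|X_i)`, `ξ_i ~ R X_i A_i`. (The cost `Y_i` is the function
`y X_i A_i ξ_i` of the record.) -/
structure IsLoggedDataset {Ω : Type*} [MeasurableSpace Ω] (μ : Measure Ω)
    {𝒳 𝒜 Ξ : Type*} [Fintype 𝒳] [MeasurableSpace 𝒳] [Fintype 𝒜] [MeasurableSpace 𝒜]
    [Fintype Ξ] [MeasurableSpace Ξ]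
    (P : stdSimplex ℝ 𝒳) (π₀ : 𝒳 → stdSimplex ℝ 𝒜) (R : 𝒳 → 𝒜 → stdSimplex ℝ Ξ)
    {n : ℕ} (D : Fin n → Ω → 𝒳 × 𝒜 × Ξ) : Prop where
  measurable : ∀ i, Measurable (D i)
  indep : iIndepFun D μ
  law : ∀ i x a ξ, μ.real {ω | D i ω = (x, a, ξ)} = P x * π₀ x a * R x a ξ

end WassersteinOPL

end

/-! Strong duality (`worstCaseExpectation_eq_dualValue`), applied to the inner and the outer
supremum, puts V in the same two-step dual form as its empirical version. Both are then values of
one functional, `dualValue`, at different mass functions. For every multiplier the inner maximum of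
the dual objective stays in [0, Ymax], so the functional moves by at most Ymax times the total
variation distance of the mass functions (`abs_dualValue_sub_le`). No bound on the multiplier is
needed, and the estimate is uniform over policies, so the policy class plays no role.

It remains to bound total variation, that is, the one-sided deviations of the empirical mass of
every subset. Exponential moments and a union bound over subsets do this: 2^|𝒳| events for the
contexts, and |𝒳||𝒜| 2^|Ξ| events for the outcomes once every pair count is at least m = n μπ μx /
2, which the lower bound on n makes likely. The pair count is random;
`measureReal_outcome_deviation` handles it without conditioning, by a weight that vanishes on
records of other pairs. -/

namespace WassersteinOPL

/-! ### Finite distributions: couplings and total variation -/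

section Simplex

variable {S : Type*} [Fintype S]

/-- Existence of the joint distribution of `(x, z)` with `x ~ P` and `z ~ K x`. -/
theorem exists_coupling_of_kernel (P : stdSimplex ℝ S) (K : S → stdSimplex ℝ S) :
    ∃ (σ : stdSimplex ℝ (S × S)) (Q : stdSimplex ℝ S), IsCoupling σ P Q ∧
      (∀ x z, σ (x, z) = P x * K x z) ∧ ∀ z, Q z = ∑ x, P x * K x z := by
  have hK : ∀ x, ∑ z, P x * K x z = P x := fun x => by
    rw [← Finset.mul_sum, stdSimplex.sum_eq_one, mul_one]
  refine ⟨⟨fun t => P t.1 * K t.1 t.2, fun t => mul_nonneg (P.2.1 _) ((K _).2.1 _), ?_⟩,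
    ⟨fun z => ∑ x, P x * K x z,
      fun z => Finset.sum_nonneg fun x _ => mul_nonneg (P.2.1 _) ((K _).2.1 _), ?_⟩,
    ⟨hK, fun _ => rfl⟩, fun _ _ => rfl, fun _ => rfl⟩
  · rw [Fintype.sum_prod_type]
    simp only [hK, stdSimplex.sum_eq_one]
  · rw [Finset.sum_comm]
    simp only [hK, stdSimplex.sum_eq_one]

theorem exists_coupling (P Q : stdSimplex ℝ S) :
    ∃ σ : stdSimplex ℝ (S × S), IsCoupling σ P Q := by
  obtain ⟨σ, Q', h, -, hQ⟩ := exists_coupling_of_kernel P fun _ => Q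
  have : Q' = Q := by
    ext z
    rw [hQ, ← Finset.sum_mul, stdSimplex.sum_eq_one, one_mul]
  exact ⟨σ, this ▸ h⟩

theorem bddAbove_expectation (U : Set (stdSimplex ℝ S)) (f : S → ℝ) :
    BddAbove (Set.range fun Q : U => ∑ s, (Q : stdSimplex ℝ S) s * f s) := by
  refine ⟨∑ s, |f s|, ?_⟩
  rintro _ ⟨Q, rfl⟩
  refine Finset.sum_le_sum fun s _ => ?_
  have h0 : 0 ≤ (Q : stdSimplex ℝ S) s := Q.1.2.1 s
  have h1 : (Q : stdSimplex ℝ S) s ≤ 1 := stdSimplex.le_one _ _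
  calc (Q : stdSimplex ℝ S) s * f s ≤ (Q : stdSimplex ℝ S) s * |f s| :=
        mul_le_mul_of_nonneg_left (le_abs_self _) h0
    _ ≤ 1 * |f s| := mul_le_mul_of_nonneg_right h1 (abs_nonneg _)
    _ = |f s| := one_mul _

/-- The difference of the two sums is largest when h is Y on {q < p} and 0 elsewhere, so a one-sided
bound on subsets suffices and the constant is Y, not 2Y. -/
theorem sum_mul_le_of_forall_subset {p q h : S → ℝ} {Y t : ℝ}
    (hh : ∀ s, 0 ≤ h s) (hhY : ∀ s, h s ≤ Y) (hY : 0 ≤ Y)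
    (ht : ∀ T : Finset S, ∑ s ∈ T, p s - ∑ s ∈ T, q s ≤ t) :
    ∑ s, p s * h s ≤ ∑ s, q s * h s + Y * t := by
  classical
  have h1 : ∑ s, (p s - q s) * h s ≤ ∑ s with q s < p s, Y * (p s - q s) := by
    rw [Finset.sum_filter]
    refine Finset.sum_le_sum fun s _ => ?_
    split_ifs with hs
    · rw [mul_comm Y]
      exact mul_le_mul_of_nonneg_left (hhY s) (by linarith)
    · exact mul_nonpos_of_nonpos_of_nonneg (by linarith) (hh s)
  rw [← Finset.mul_sum, Finset.sum_sub_distrib] at h1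
  have h2 := mul_le_mul_of_nonneg_left (ht (Finset.univ.filter fun s => q s < p s)) hY
  simp only [sub_mul, Finset.sum_sub_distrib] at h1
  linarith

/-- Both masses are 1, so passing to the complement of T flips the sign of the deviation. -/
theorem sum_sub_sum_le_symm {p q : S → ℝ} (hp : p ∈ stdSimplex ℝ S) (hq : q ∈ stdSimplex ℝ S)
    {t : ℝ} (ht : ∀ T : Finset S, ∑ s ∈ T, p s - ∑ s ∈ T, q s ≤ t) (T : Finset S) :
    ∑ s ∈ T, q s - ∑ s ∈ T, p s ≤ t := by
  classical
  have h1 := Finset.sum_add_sum_compl T p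
  have h2 := Finset.sum_add_sum_compl T q
  have := ht Tᶜ
  rw [hp.2] at h1
  rw [hq.2] at h2
  linarith

end Simplex

/-! ### Wasserstein duality and stability of the dual value -/

theorem iSup_sub_le {S : Type*} [PseudoMetricSpace S] [Nonempty S] {f : S → ℝ} {Y : ℝ} (hf : ∀ s, f s ≤ Y) (l : ℝ≥0) (x : S) :
    ⨆ z, (f z - (l : ℝ) * dist x z ^ 2) ≤ Y :=
  ciSup_le fun z => by
    have : 0 ≤ (l : ℝ) * dist x z ^ 2 := by positivity
    linarith [hf z]

section Duality

variable {S : Type*} [Fintype S] [PseudoMetricSpace S]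

theorem transportCost_nonneg (σ : stdSimplex ℝ (S × S)) : 0 ≤ transportCost σ :=
  Finset.sum_nonneg fun x _ => Finset.sum_nonneg fun z _ =>
    mul_nonneg (σ.2.1 (x, z)) (sq_nonneg _)

theorem wassersteinDist_le_transportCost {P Q : stdSimplex ℝ S} {σ : stdSimplex ℝ (S × S)}
    (h : IsCoupling σ P Q) : wassersteinDist P Q ≤ transportCost σ :=
  csInf_le ⟨0, by rintro _ ⟨σ, -, rfl⟩; exact transportCost_nonneg σ⟩ ⟨σ, h, rfl⟩

theorem le_iSup_sub (f : S → ℝ) (l : ℝ) (x z : S) :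
    f z - l * dist x z ^ 2 ≤ ⨆ z, (f z - l * dist x z ^ 2) :=
  le_ciSup (f := fun z => f z - l * dist x z ^ 2) (Set.finite_range _).bddAbove z

theorem self_le_iSup_sub (f : S → ℝ) (l : ℝ) (x : S) :
    f x ≤ ⨆ z, (f z - l * dist x z ^ 2) := by
  simpa using le_iSup_sub f l x x

/-- Weak duality. -/
theorem sum_mul_le_dual {ε : ℝ} {P Q : stdSimplex ℝ S} (hQ : Q ∈ uncertaintySet ε P)
    (f : S → ℝ) (l : ℝ≥0) :
    ∑ s, Q s * f s ≤ ε * l + ∑ x, P x * ⨆ z, (f z - (l : ℝ) * dist x z ^ 2) := by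
  have key : ∀ σ : stdSimplex ℝ (S × S), IsCoupling σ P Q →
      ∑ s, Q s * f s - ∑ x, P x * ⨆ z, (f z - (l : ℝ) * dist x z ^ 2)
        ≤ l * transportCost σ := by
    intro σ hσ
    have h1 : ∑ s, Q s * f s = ∑ x, ∑ z, σ (x, z) * f z := by
      rw [Finset.sum_comm]
      exact Finset.sum_congr rfl fun z _ => by rw [← hσ.2 z, Finset.sum_mul]
    have h2 : ∑ x, ∑ z, σ (x, z) * (f z - l * dist x z ^ 2)
        ≤ ∑ x, P x * ⨆ z, (f z - (l : ℝ) * dist x z ^ 2) := by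
      refine Finset.sum_le_sum fun x _ => ?_
      rw [← hσ.1 x, Finset.sum_mul]
      exact Finset.sum_le_sum fun z _ =>
        mul_le_mul_of_nonneg_left (le_iSup_sub f l x z) (σ.2.1 _)
    have h3 : ∑ x, ∑ z, σ (x, z) * (f z - l * dist x z ^ 2)
        = ∑ x, ∑ z, σ (x, z) * f z - l * transportCost σ := by
      simp only [transportCost, Finset.mul_sum, ← Finset.sum_sub_distrib]
      exact Finset.sum_congr rfl fun x _ => Finset.sum_congr rfl fun z _ => by ring
    linarith
  have h4 : ∑ s, Q s * f s - ∑ x, P x * ⨆ z, (f z - (l : ℝ) * dist x z ^ 2)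
      ≤ l * wassersteinDist P Q := by
    obtain ⟨σ₀, hσ₀⟩ := exists_coupling P Q
    -- Passing to the infimum over couplings divides by l; for l = 0 any single coupling already
    -- gives the claim.
    rcases l.2.eq_or_lt with hl | hl
    · have := key σ₀ hσ₀
      have hl' : (l : ℝ) = 0 := hl.symm
      rw [hl'] at this ⊢
      linarith
    · have hl' : (0 : ℝ) < l := hl
      rw [mul_comm, ← div_le_iff₀ hl']
      refine le_csInf ⟨_, σ₀, hσ₀, rfl⟩ ?_
      rintro _ ⟨σ, hσ, rfl⟩
      rw [div_le_iff₀ hl', mul_comm]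
      exact key σ hσ
  have h5 : (l : ℝ) * wassersteinDist P Q ≤ l * ε := mul_le_mul_of_nonneg_left hQ l.2
  linarith

theorem mem_uncertaintySet_self {ε : ℝ} (hε : 0 ≤ ε) (P : stdSimplex ℝ S) :
    P ∈ uncertaintySet ε P := by
  classical
  obtain ⟨σ, Q, h, hσ, hQ⟩ := exists_coupling_of_kernel P fun x => stdSimplex.vertex (S := ℝ) x
  have : Q = P := by
    ext z
    rw [hQ]
    simp [stdSimplex.vertex, Pi.single_apply]
  subst this
  refine (wassersteinDist_le_transportCost h).trans (le_trans (le_of_eq ?_) hε)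
  refine Finset.sum_eq_zero fun x _ => Finset.sum_eq_zero fun z _ => ?_
  rw [hσ]
  by_cases hxz : z = x
  · simp [hxz]
  · simp [stdSimplex.vertex, hxz]

/-- Some multiplier has dual objective at most the primal value. -/
theorem exists_multiplier {ε : ℝ} (hε : 0 < ε) (P : stdSimplex ℝ S) (f : S → ℝ) :
    ∃ l : ℝ≥0, ε * l + ∑ x, P x * ⨆ z, (f z - (l : ℝ) * dist x z ^ 2)
      ≤ worstCaseExpectation ε P f := by
  classical
  have hne : Nonempty S := by
    by_contra h
    rw [not_nonempty_iff] at h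
    simpa using stdSimplex.sum_eq_one P
  set v := worstCaseExpectation ε P f with hv
  -- Transport plans are parametrized by kernels, in which cost and value are linear. The attainable
  -- pairs form a convex set C, disjoint from the pairs with cost below ε and value above v; the
  -- slope of a separating line is the multiplier.
  let cost : (S → S → ℝ) → ℝ := fun k => ∑ x, ∑ z, P x * k x z * dist x z ^ 2
  let val : (S → S → ℝ) → ℝ := fun k => ∑ x, ∑ z, P x * k x z * f z
  let C : Set (ℝ × ℝ) :=
    (fun k => (cost k, val k)) '' {k : S → S → ℝ | ∀ x, k x ∈ stdSimplex ℝ S}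
  let U : Set (ℝ × ℝ) := Set.Iio ε ×ˢ Set.Ioi v
  have hC : Convex ℝ C := by
    refine Convex.is_linear_image (f := fun k => (cost k, val k)) ?_ ⟨?_, ?_⟩
    · intro k hk k' hk' a b ha hb hab x
      exact convex_stdSimplex ℝ S (hk x) (hk' x) ha hb hab
    · intro k k'
      simp only [cost, val, Pi.add_apply, Prod.mk_add_mk, ← Finset.sum_add_distrib]
      congr 1 <;>
        exact Finset.sum_congr rfl fun x _ => Finset.sum_congr rfl fun z _ => by ring
    · intro c k
      simp only [cost, val, Pi.smul_apply, smul_eq_mul, Prod.smul_mk, Finset.mul_sum]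
      congr 1 <;>
        exact Finset.sum_congr rfl fun x _ => Finset.sum_congr rfl fun z _ => by ring
  have hU : Convex ℝ U := (convex_Iio ε).prod (convex_Ioi v)
  have hdisj : Disjoint U C := by
    rw [Set.disjoint_left]
    rintro _ ⟨h1, h2⟩ ⟨k, hk, rfl⟩
    obtain ⟨σ, Q, hσQ, hσ, hQ⟩ := exists_coupling_of_kernel P fun x => ⟨k x, hk x⟩
    have hcost : transportCost σ = cost k := by
      simp only [transportCost, hσ, cost]; rfl
    have hval : ∑ s, Q s * f s = val k := by
      simp only [hQ, val, Finset.sum_mul]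
      rw [Finset.sum_comm]; rfl
    have hmem : Q ∈ uncertaintySet ε P :=
      (wassersteinDist_le_transportCost hσQ).trans (hcost.trans_le (le_of_lt h1))
    have h3 : ∑ s, Q s * f s ≤ v :=
      le_ciSup (bddAbove_expectation (uncertaintySet ε P) f) ⟨Q, hmem⟩
    rw [hval] at h3
    exact absurd h2 (not_lt.2 h3)
  obtain ⟨F, u, hFU, hFC⟩ :=
    geometric_hahn_banach_open hU (isOpen_Iio.prod isOpen_Ioi) hC hdisj
  set α := F (1, 0) with hα
  set β := F (0, 1) with hβ
  have hF : ∀ s w, F (s, w) = s * α + w * β := by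
    intro s w
    have : ((s, w) : ℝ × ℝ) = s • (1, 0) + w • (0, 1) := by simp
    rw [this, map_add, map_smul, map_smul, smul_eq_mul, smul_eq_mul]
  have hU' : ∀ s w, s < ε → v < w → s * α + w * β < u := fun s w hs hw => by
    rw [← hF]; exact hFU (s, w) ⟨hs, hw⟩
  -- U is unbounded towards small cost and large value, which fixes the signs of α and β; the second
  -- entry of the `min` (below, of the `max`) is where F would reach u.
  have hα0 : 0 ≤ α := by
    by_contra hneg
    push Not at hneg
    have h1 := hU' (min (ε - 1) ((u - (v + 1) * β) / α)) (v + 1)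
      ((min_le_left _ _).trans_lt (by linarith)) (by linarith)
    have h2 := mul_le_mul_of_nonpos_right (min_le_right (ε - 1) ((u - (v + 1) * β) / α)) hneg.le
    rw [div_mul_cancel₀ _ hneg.ne] at h2
    linarith
  have hβ0 : β ≤ 0 := by
    by_contra hpos
    push Not at hpos
    have h1 := hU' (ε - 1) (max (v + 1) ((u - (ε - 1) * α) / β)) (by linarith)
      ((by linarith : v < v + 1).trans_le (le_max_left _ _))
    have h2 := mul_le_mul_of_nonneg_right (le_max_right (v + 1) ((u - (ε - 1) * α) / β)) hpos.le
    rw [div_mul_cancel₀ _ hpos.ne'] at h2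
    linarith
  have hlim : ε * α + v * β ≤ u := by
    have hmem : (ε, v) ∈ closure U := by
      rw [closure_prod_eq, closure_Iio, closure_Ioi]
      exact ⟨le_refl ε, le_refl v⟩
    have hcl : closure U ⊆ {p | F p ≤ u} :=
      closure_minimal (fun p hp => (hFU p hp).le) (isClosed_le F.continuous continuous_const)
    have := hcl hmem
    rwa [Set.mem_ofPred_eq, hF] at this
  have hCk : ∀ g : S → S, u ≤ (∑ x, P x * dist x (g x) ^ 2) * α + (∑ x, P x * f (g x)) * β := by
    intro g
    have := hFC _ ⟨fun x => Pi.single (g x) 1, fun x => single_mem_stdSimplex ℝ (g x), rfl⟩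
    rw [hF] at this
    simpa [cost, val, Pi.single_apply] using this
  -- Slater's condition: the identity plan has cost 0 < ε, so the separating line is not vertical.
  have hβneg : β < 0 := by
    refine lt_of_le_of_ne hβ0 fun h0 => ?_
    have h1 := hCk id
    simp only [h0, id, dist_self] at h1
    have h2 := hU' 0 (v + 1) hε (by linarith)
    have h4 := hU' (ε / 2) (v + 1) (by linarith) (by linarith)
    simp only [h0] at h2 h4 hlim
    norm_num at h1 h2
    linarith
  have hγ : 0 < -β := by linarith
  refine ⟨⟨α / (-β), div_nonneg hα0 hγ.le⟩, ?_⟩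
  -- Sending each x to a maximizer g x makes the dual objective the Lagrangian of a deterministic
  -- plan, to which `hCk` applies; together with `hlim` this is the claim multiplied by -β.
  have hmax : ∀ x, ∃ z, f z - α / (-β) * dist x z ^ 2 = ⨆ z, (f z - α / (-β) * dist x z ^ 2) :=
    fun x => exists_eq_ciSup_of_finite
  choose g hg using hmax
  change ε * (α / (-β)) + ∑ x, P x * ⨆ z, (f z - α / (-β) * dist x z ^ 2) ≤ v
  simp only [← hg]
  have h1 := hCk g
  have h2 : ∑ x, P x * (f (g x) - α / (-β) * dist x (g x) ^ 2)
      = ∑ x, P x * f (g x) - α / (-β) * ∑ x, P x * dist x (g x) ^ 2 := by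
    rw [Finset.mul_sum, ← Finset.sum_sub_distrib]
    exact Finset.sum_congr rfl fun x _ => by ring
  rw [h2]
  set A := ∑ x, P x * f (g x)
  set B := ∑ x, P x * dist x (g x) ^ 2
  have h3 : (-β) * (ε * (α / (-β)) + (A - α / (-β) * B)) = ε * α - A * β - α * B := by
    have : β ≠ 0 := hβneg.ne
    field_simp
    ring
  refine le_of_mul_le_mul_left ?_ hγ
  rw [h3]
  linarith

theorem bddBelow_dual {ε : ℝ} (hε : 0 ≤ ε) {p f : S → ℝ} (hp : ∀ s, 0 ≤ p s)
    (hf : ∀ s, 0 ≤ f s) :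
    BddBelow (Set.range fun l : ℝ≥0 =>
      ε * (l : ℝ) + ∑ x, p x * ⨆ z, (f z - (l : ℝ) * dist x z ^ 2)) := by
  refine ⟨0, ?_⟩
  rintro _ ⟨l, rfl⟩
  exact add_nonneg (mul_nonneg hε l.2) (Finset.sum_nonneg fun x _ =>
    mul_nonneg (hp x) ((hf x).trans (self_le_iSup_sub f l x)))

/-- Strong duality for the worst-case expectation over a Wasserstein ball. -/
theorem worstCaseExpectation_eq_dualValue {ε : ℝ} (hε : 0 < ε) (P : stdSimplex ℝ S)
    {f : S → ℝ} (hf : ∀ s, 0 ≤ f s) :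
    worstCaseExpectation ε P f = dualValue ε P f := by
  have : Nonempty (uncertaintySet ε P) := ⟨⟨P, mem_uncertaintySet_self hε.le P⟩⟩
  apply le_antisymm
  · exact ciSup_le fun Q => le_ciInf fun l => sum_mul_le_dual Q.2 f l
  · obtain ⟨l, hl⟩ := exists_multiplier hε P f
    exact (ciInf_le (bddBelow_dual hε.le P.2.1 hf) l).trans hl

theorem dualValue_nonneg {ε : ℝ} (hε : 0 ≤ ε) {p f : S → ℝ} (hp : ∀ s, 0 ≤ p s)
    (hf : ∀ s, 0 ≤ f s) : 0 ≤ dualValue ε p f :=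
  le_ciInf fun l => add_nonneg (mul_nonneg hε l.2) (Finset.sum_nonneg fun x _ =>
    mul_nonneg (hp x) ((hf x).trans (self_le_iSup_sub f l x)))

theorem dualValue_le [Nonempty S] {ε : ℝ} (hε : 0 ≤ ε) {p f : S → ℝ} {Y : ℝ}
    (hp : p ∈ stdSimplex ℝ S) (hf : ∀ s, 0 ≤ f s) (hfY : ∀ s, f s ≤ Y) :
    dualValue ε p f ≤ Y := by
  refine (ciInf_le (bddBelow_dual hε hp.1 hf) 0).trans ?_
  simp only [NNReal.coe_zero, mul_zero, zero_add]
  calc ∑ x, p x * ⨆ z, (f z - 0 * dist x z ^ 2) ≤ ∑ x, p x * Y :=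
        Finset.sum_le_sum fun x _ =>
          mul_le_mul_of_nonneg_left (iSup_sub_le hfY 0 x) (hp.1 x)
    _ = Y := by rw [← Finset.sum_mul, hp.2, one_mul]

/-- For each fixed l the inner supremum of g lies in [0, Y]: z = x gives the lower bound,
nonnegativity of the penalty the upper one. Changing p to q thus costs Y * t uniformly in l, and
replacing f by g costs b because p has mass 1. -/
theorem dualValue_le_add [Nonempty S] {ε : ℝ} (hε : 0 ≤ ε) {p q f g : S → ℝ} {Y t b : ℝ}
    (hp : p ∈ stdSimplex ℝ S)
    (hf : ∀ s, 0 ≤ f s) (hfY : ∀ s, f s ≤ Y)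
    (hg : ∀ s, 0 ≤ g s) (hgY : ∀ s, g s ≤ Y) (hfg : ∀ s, f s ≤ g s + b)
    (ht : ∀ T : Finset S, ∑ s ∈ T, p s - ∑ s ∈ T, q s ≤ t) :
    dualValue ε p f ≤ dualValue ε q g + (Y * t + b) := by
  have hY : 0 ≤ Y := (hf (Classical.arbitrary S)).trans (hfY _)
  rw [← sub_le_iff_le_add]
  refine le_ciInf fun l => ?_
  rw [sub_le_iff_le_add]
  refine (ciInf_le (bddBelow_dual hε hp.1 hf) l).trans ?_
  have h1 : ∑ x, p x * ⨆ z, (f z - (l : ℝ) * dist x z ^ 2)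
      ≤ ∑ x, p x * ((⨆ z, (g z - (l : ℝ) * dist x z ^ 2)) + b) := by
    refine Finset.sum_le_sum fun x _ => mul_le_mul_of_nonneg_left ?_ (hp.1 x)
    exact ciSup_le fun z => by linarith [hfg z, le_iSup_sub g l x z]
  have h2 : ∑ x, p x * ((⨆ z, (g z - (l : ℝ) * dist x z ^ 2)) + b)
      = ∑ x, p x * (⨆ z, (g z - (l : ℝ) * dist x z ^ 2)) + b := by
    simp only [mul_add, Finset.sum_add_distrib, ← Finset.sum_mul, hp.2, one_mul]
  have h3 := sum_mul_le_of_forall_subset (p := p) (q := q)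
    (h := fun x => ⨆ z, (g z - (l : ℝ) * dist x z ^ 2))
    (fun x => (hg x).trans (self_le_iSup_sub g l x)) (iSup_sub_le hgY l) hY ht
  linarith

/-- Stability of the dual value under total variation perturbations of the mass function and
uniform perturbations of the objective. -/
theorem abs_dualValue_sub_le [Nonempty S] {ε : ℝ} (hε : 0 ≤ ε) {p q f g : S → ℝ} {Y t b : ℝ}
    (hp : p ∈ stdSimplex ℝ S) (hq : q ∈ stdSimplex ℝ S)
    (hf : ∀ s, 0 ≤ f s) (hfY : ∀ s, f s ≤ Y)
    (hg : ∀ s, 0 ≤ g s) (hgY : ∀ s, g s ≤ Y) (hfg : ∀ s, |f s - g s| ≤ b)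
    (ht : ∀ T : Finset S, ∑ s ∈ T, p s - ∑ s ∈ T, q s ≤ t) :
    |dualValue ε p f - dualValue ε q g| ≤ Y * t + b := by
  have h1 := dualValue_le_add hε hp hf hfY hg hgY
    (b := b) (fun s => by linarith [(abs_le.1 (hfg s)).2]) ht
  have h2 := dualValue_le_add hε hq hg hgY hf hfY
    (b := b) (fun s => by linarith [(abs_le.1 (hfg s)).1]) (sum_sub_sum_le_symm hp hq ht)
  rw [abs_le]
  constructor <;> linarith

end Duality

theorem abs_iInf_sub_iInf_le {ι : Type*} [Nonempty ι] {f g : ι → ℝ} {b : ℝ}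
    (hf : BddBelow (Set.range f)) (hg : BddBelow (Set.range g)) (h : ∀ i, |f i - g i| ≤ b) :
    |(⨅ i, f i) - ⨅ i, g i| ≤ b := by
  have h1 : (⨅ i, f i) - b ≤ ⨅ i, g i :=
    le_ciInf fun i => by linarith [ciInf_le hf i, (abs_le.1 (h i)).2]
  have h2 : (⨅ i, g i) - b ≤ ⨅ i, f i :=
    le_ciInf fun i => by linarith [ciInf_le hg i, (abs_le.1 (h i)).1]
  rw [abs_le]
  constructor <;> linarith

/-! ### Exponential moments and Chernoff bounds -/

/-- Hoeffding's lemma for a `[0, 1]`-valued function on a finite probability space. -/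
theorem sum_mul_exp_le {T : Type*} [Fintype T] {p : T → ℝ} (hp : p ∈ stdSimplex ℝ T)
    {h : T → ℝ} (hh : ∀ t, h t ∈ Set.Icc (0 : ℝ) 1) (lam : ℝ) :
    ∑ t, p t * Real.exp (lam * (h t - ∑ s, p s * h s) - lam ^ 2 / 8) ≤ 1 := by
  let _ : MeasurableSpace T := ⊤
  let ν : Measure T := ∑ t, ENNReal.ofReal (p t) • Measure.dirac t
  have hint : ∀ g : T → ℝ, ∫ t, g t ∂ν = ∑ t, p t * g t := by
    intro g
    rw [integral_finsetSum_measure]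
    · refine Finset.sum_congr rfl fun t _ => ?_
      rw [integral_smul_measure, integral_dirac, ENNReal.toReal_ofReal (hp.1 t), smul_eq_mul]
    · exact fun t _ => (integrable_dirac (by simp)).smul_measure ENNReal.ofReal_ne_top
  have hν : IsProbabilityMeasure ν := ⟨by
    simp only [ν, Measure.coe_finsetSum, Finset.sum_apply, Measure.smul_apply, measure_univ,
      smul_eq_mul, mul_one]
    rw [← ENNReal.ofReal_sum_of_nonneg fun t _ => hp.1 t, hp.2, ENNReal.ofReal_one]⟩
  have hsub := (hasSubgaussianMGF_of_mem_Icc (μ := ν) (X := h) (a := 0) (b := 1)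
    measurable_from_top.aemeasurable (Filter.Eventually.of_forall hh)).mgf_le lam
  rw [mgf, hint, hint] at hsub
  -- The variance proxy of a variable in [0, 1] is 1/4.
  have hc : (((‖(1 : ℝ) - 0‖₊ / 2) ^ 2 : ℝ≥0) : ℝ) * lam ^ 2 / 2 = lam ^ 2 / 8 := by
    simp
    ring
  rw [hc] at hsub
  simp only [Real.exp_sub _ (lam ^ 2 / 8), ← mul_div_assoc]
  rw [← Finset.sum_div]
  exact div_le_one_of_le₀ hsub (Real.exp_pos _).le

section Chernoff

variable {Ω : Type*} [MeasurableSpace Ω] {μ : Measure Ω} [IsProbabilityMeasure μ]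
  {T : Type*} [Fintype T] [MeasurableSpace T] [MeasurableSingletonClass T]

theorem integral_comp_eq_sum {X : Ω → T} (hX : Measurable X) {r : T → ℝ}
    (hr : ∀ t, μ.real {ω | X ω = t} = r t) (g : T → ℝ) :
    ∫ ω, g (X ω) ∂μ = ∑ t, r t * g t := by
  have : IsProbabilityMeasure (μ.map X) := Measure.isProbabilityMeasure_map hX.aemeasurable
  rw [← integral_map (φ := X) (f := g) hX.aemeasurable
    (measurable_of_countable g).aestronglyMeasurable, integral_fintype .of_finite]
  refine Finset.sum_congr rfl fun t _ => ?_
  rw [map_measureReal_apply hX (measurableSet_singleton t), ← hr t, smul_eq_mul]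
  rfl

/-- Chernoff bound for a sum of a function of independent records with exponential moment at
most one. -/
theorem measureReal_sum_ge_le_exp_neg {n : ℕ} {D : Fin n → Ω → T} (hD : ∀ i, Measurable (D i))
    (hind : iIndepFun D μ) {r : T → ℝ} (hr : ∀ i t, μ.real {ω | D i ω = t} = r t)
    {w : T → ℝ} (hw : ∑ t, r t * Real.exp (w t) ≤ 1) (c : ℝ) :
    μ.real {ω | c ≤ ∑ i, w (D i ω)} ≤ Real.exp (-c) := by
  have hwm : Measurable w := measurable_of_countable w
  have hm : ∀ i, Measurable fun ω => w (D i ω) := fun i => hwm.comp (hD i)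
  have hind' : iIndepFun (fun i ω => w (D i ω)) μ := hind.comp (fun _ => w) fun _ => hwm
  have hint : Integrable (fun ω => Real.exp (1 * (∑ i, fun ω => w (D i ω)) ω)) μ :=
    hind'.integrable_exp_mul_sum hm fun i _ =>
      (Integrable.of_finite (f := fun t => Real.exp (1 * w t))).comp_measurable (hD i)
  have h := measure_ge_le_exp_mul_mgf c zero_le_one hint
  rw [hind'.mgf_sum hm] at h
  have h1 : ∏ i, mgf (fun ω => w (D i ω)) μ 1 ≤ 1 := by
    refine Finset.prod_le_one (fun i _ => mgf_nonneg) fun i _ => ?_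
    rw [mgf, integral_comp_eq_sum (hD i) (hr i) fun t => Real.exp (1 * w t)]
    simpa using hw
  simp only [Finset.sum_apply, neg_mul, one_mul] at h
  exact h.trans (mul_le_of_le_one_right (Real.exp_pos _).le h1)

/-- Chernoff form of Hoeffding's inequality for a `[0, 1]`-valued function of the records. -/
theorem measureReal_hoeffding {n : ℕ} {D : Fin n → Ω → T} (hD : ∀ i, Measurable (D i))
    (hind : iIndepFun D μ) {r : T → ℝ} (hr : ∀ i t, μ.real {ω | D i ω = t} = r t)
    (hr1 : r ∈ stdSimplex ℝ T) {h : T → ℝ} (hh : ∀ t, h t ∈ Set.Icc (0 : ℝ) 1) (lam c : ℝ) :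
    μ.real {ω | c + n * (lam ^ 2 / 8) ≤ lam * (∑ i, h (D i ω) - n * ∑ t, r t * h t)}
      ≤ Real.exp (-c) := by
  refine le_trans (le_of_eq ?_)
    (measureReal_sum_ge_le_exp_neg hD hind hr (sum_mul_exp_le hr1 hh lam) c)
  congr 1
  ext ω
  simp only [Set.mem_ofPred_eq, Finset.sum_sub_distrib, ← Finset.mul_sum, Finset.sum_const,
    Finset.card_univ, Fintype.card_fin, nsmul_eq_mul]
  constructor <;> intro h <;> linarith

end Chernoff

/-! ### Empirical frequencies as sums of indicators over the records -/

section Counting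

variable {𝒳 𝒜 Ξ : Type*} {n : ℕ}

open scoped Classical in
theorem pairCount_eq_sum (D : Fin n → 𝒳 × 𝒜 × Ξ) (x : 𝒳) (a : 𝒜) :
    (pairCount D x a : ℝ) = ∑ i, if (D i).1 = x ∧ (D i).2.1 = a then (1 : ℝ) else 0 := by
  rw [pairCount, Finset.natCast_card_filter]

open scoped Classical in
theorem sum_empContext (D : Fin n → 𝒳 × 𝒜 × Ξ) (T : Finset 𝒳) :
    ∑ x ∈ T, empContext D x = (∑ i, if (D i).1 ∈ T then (1 : ℝ) else 0) / n := by
  simp only [empContext, Finset.natCast_card_filter]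
  rw [← Finset.sum_div, Finset.sum_comm]
  simp

open scoped Classical in
theorem sum_empOutcome (D : Fin n → 𝒳 × 𝒜 × Ξ) (x : 𝒳) (a : 𝒜) (T : Finset Ξ) :
    ∑ ξ ∈ T, empOutcome D x a ξ =
      (∑ i, if ((D i).1 = x ∧ (D i).2.1 = a) ∧ (D i).2.2 ∈ T then (1 : ℝ) else 0)
        / pairCount D x a := by
  simp only [empOutcome, Finset.natCast_card_filter]
  rw [← Finset.sum_div, Finset.sum_comm]
  congr 1
  refine Finset.sum_congr rfl fun i _ => ?_
  by_cases h : (D i).1 = x ∧ (D i).2.1 = a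
  · simp [Prod.ext_iff, h]
  · have : ∀ ξ, D i ≠ (x, a, ξ) := fun ξ hξ => h (by simp [hξ])
    simp [this, h]

theorem empContext_mem_stdSimplex [Fintype 𝒳] (hn : 0 < n) (D : Fin n → 𝒳 × 𝒜 × Ξ) :
    empContext D ∈ stdSimplex ℝ 𝒳 := by
  refine ⟨fun x => by unfold empContext; positivity, ?_⟩
  rw [sum_empContext]
  simp [hn.ne']

theorem empOutcome_mem_stdSimplex [Fintype Ξ] {D : Fin n → 𝒳 × 𝒜 × Ξ} {x : 𝒳} {a : 𝒜}
    (h : 0 < pairCount D x a) : empOutcome D x a ∈ stdSimplex ℝ Ξ := by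
  classical
  refine ⟨fun x => by unfold empOutcome; positivity, ?_⟩
  rw [sum_empOutcome, div_eq_one_iff_eq (by exact_mod_cast h.ne'), pairCount_eq_sum]
  exact Finset.sum_congr rfl fun i _ => if_congr (by simp) rfl rfl

end Counting

/-! ### Deterministic comparison of the empirical and true robust values -/

section Stability

variable {𝒳 𝒜 Ξ : Type*} [Fintype 𝒳] [PseudoMetricSpace 𝒳] [Fintype 𝒜]
  [Fintype Ξ] [PseudoMetricSpace Ξ] {n : ℕ}

theorem sum_mul_mem_Icc (p : stdSimplex ℝ 𝒜) {f : 𝒜 → ℝ} {Y : ℝ}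
    (hf : ∀ a, f a ∈ Set.Icc 0 Y) : ∑ a, p a * f a ∈ Set.Icc 0 Y := by
  refine ⟨Finset.sum_nonneg fun a _ => mul_nonneg (p.2.1 a) (hf a).1, ?_⟩
  calc ∑ a, p a * f a ≤ ∑ a, p a * Y :=
        Finset.sum_le_sum fun a _ => mul_le_mul_of_nonneg_left (hf a).2 (p.2.1 a)
    _ = Y := by rw [← Finset.sum_mul, stdSimplex.sum_eq_one, one_mul]

theorem abs_sum_mul_sub_sum_mul_le (p : stdSimplex ℝ 𝒜) {f g : 𝒜 → ℝ} {b : ℝ}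
    (h : ∀ a, |f a - g a| ≤ b) : |∑ a, p a * f a - ∑ a, p a * g a| ≤ b := by
  rw [← Finset.sum_sub_distrib]
  calc |∑ a, (p a * f a - p a * g a)| ≤ ∑ a, |p a * f a - p a * g a| :=
        Finset.abs_sum_le_sum_abs _ _
    _ ≤ ∑ a, p a * b := by
        refine Finset.sum_le_sum fun a _ => ?_
        rw [← mul_sub, abs_mul, abs_of_nonneg (stdSimplex.zero_le p a)]
        exact mul_le_mul_of_nonneg_left (h a) (p.2.1 a)
    _ = b := by rw [← Finset.sum_mul, stdSimplex.sum_eq_one, one_mul]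

theorem dualValue_mem_Icc [Nonempty Ξ] {ε : ℝ} (hε : 0 ≤ ε) {p f : Ξ → ℝ} {Y : ℝ}
    (hp : p ∈ stdSimplex ℝ Ξ) (hf : ∀ s, f s ∈ Set.Icc 0 Y) : dualValue ε p f ∈ Set.Icc 0 Y :=
  ⟨dualValue_nonneg hε hp.1 fun s => (hf s).1,
    dualValue_le hε hp (fun s => (hf s).1) fun s => (hf s).2⟩

/-- The robust value through the two-step dual problem. -/
theorem robustValue_eq_dualValue [Nonempty Ξ] {εx εc Y : ℝ} (hεx : 0 < εx) (hεc : 0 < εc)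
    (P : stdSimplex ℝ 𝒳) (R : 𝒳 → 𝒜 → stdSimplex ℝ Ξ) {y : 𝒳 → 𝒜 → Ξ → ℝ}
    (hy : ∀ x a ξ, y x a ξ ∈ Set.Icc 0 Y) (π : 𝒳 → stdSimplex ℝ 𝒜) :
    robustValue εx εc P R y π =
      dualValue εx P fun x => ∑ a, π x a * dualValue εc (R x a) (y x a) := by
  have h : ∀ x a, worstCaseExpectation εc (R x a) (y x a) = dualValue εc (R x a) (y x a) :=
    fun x a => worstCaseExpectation_eq_dualValue hεc _ fun ξ => (hy x a ξ).1
  simp only [robustValue, h]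
  exact worstCaseExpectation_eq_dualValue hεx P fun x =>
    (sum_mul_mem_Icc (π x) fun a => dualValue_mem_Icc hεc.le (R x a).2 (hy x a)).1

/-- Stability is used twice: the inner dual values share the cost y (b = 0) and differ by at most Y
* t. Averaging over actions preserves this, and it becomes the perturbation b of the outer
objective. -/
theorem abs_iInf_empRobustValue_sub_le [Nonempty 𝒳] [Nonempty Ξ] {εx εc Y : ℝ}
    (hεx : 0 < εx) (hεc : 0 < εc)
    (P : stdSimplex ℝ 𝒳) (R : 𝒳 → 𝒜 → stdSimplex ℝ Ξ) {y : 𝒳 → 𝒜 → Ξ → ℝ}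
    (hy : ∀ x a ξ, y x a ξ ∈ Set.Icc 0 Y) {Pol : Set (𝒳 → stdSimplex ℝ 𝒜)} (hPol : Pol.Nonempty)
    (hn : 0 < n) {D : Fin n → 𝒳 × 𝒜 × Ξ} (hcount : ∀ x a, 0 < pairCount D x a) {s t : ℝ}
    (hs : ∀ T : Finset 𝒳, ∑ x ∈ T, empContext D x - ∑ x ∈ T, P x ≤ s)
    (ht : ∀ x a, ∀ T : Finset Ξ, ∑ ξ ∈ T, empOutcome D x a ξ - ∑ ξ ∈ T, R x a ξ ≤ t) :
    |(⨅ π : Pol, empRobustValue εx εc D y π) - ⨅ π : Pol, robustValue εx εc P R y π|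
      ≤ Y * (s + t) := by
  have : Nonempty Pol := hPol.to_subtype
  have hO := fun x a => empOutcome_mem_stdSimplex (hcount x a)
  have hC := empContext_mem_stdSimplex hn D
  have hf := fun (π : 𝒳 → stdSimplex ℝ 𝒜) x => sum_mul_mem_Icc (π x) fun a =>
    dualValue_mem_Icc hεc.le (hO x a) (hy x a)
  have hg := fun (π : 𝒳 → stdSimplex ℝ 𝒜) x => sum_mul_mem_Icc (π x) fun a =>
    dualValue_mem_Icc hεc.le (R x a).2 (hy x a)
  simp only [robustValue_eq_dualValue hεx hεc P R hy]
  refine abs_iInf_sub_iInf_le ⟨0, ?_⟩ ⟨0, ?_⟩ fun π => ?_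
  · rintro _ ⟨π, rfl⟩
    exact (dualValue_mem_Icc hεx.le hC (hf π)).1
  · rintro _ ⟨π, rfl⟩
    exact (dualValue_mem_Icc hεx.le P.2 (hg π)).1
  · rw [mul_add]
    refine abs_dualValue_sub_le hεx.le hC P.2 (fun x => (hf π x).1) (fun x => (hf π x).2)
      (fun x => (hg π x).1) (fun x => (hg π x).2) (fun x => ?_) hs
    refine abs_sum_mul_sub_sum_mul_le (π.1 x) fun a => ?_
    have := abs_dualValue_sub_le hεc.le (hO x a) (R x a).2 (fun ξ => (hy x a ξ).1)
      (fun ξ => (hy x a ξ).2) (fun ξ => (hy x a ξ).1) (fun ξ => (hy x a ξ).2)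
      (b := 0) (fun ξ => by simp) (ht x a)
    rwa [add_zero] at this

end Stability

/-! ### Concentration of the empirical frequencies -/

section Concentration

variable {Ω : Type*} [MeasurableSpace Ω] {μ : Measure Ω} [IsProbabilityMeasure μ]
  {𝒳 𝒜 Ξ : Type*} [Fintype 𝒳] [MeasurableSpace 𝒳] [MeasurableSingletonClass 𝒳]
  [Fintype 𝒜] [MeasurableSpace 𝒜] [MeasurableSingletonClass 𝒜]
  [Fintype Ξ] [MeasurableSpace Ξ] [MeasurableSingletonClass Ξ]
  {P : stdSimplex ℝ 𝒳} {π₀ : 𝒳 → stdSimplex ℝ 𝒜} {R : 𝒳 → 𝒜 → stdSimplex ℝ Ξ}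
  {n : ℕ} {D : Fin n → Ω → 𝒳 × 𝒜 × Ξ}

theorem sum_law_mul {𝒳 𝒜 Ξ : Type*} [Fintype 𝒳] [Fintype 𝒜] [Fintype Ξ]
    (P : stdSimplex ℝ 𝒳) (π₀ : 𝒳 → stdSimplex ℝ 𝒜) (R : 𝒳 → 𝒜 → stdSimplex ℝ Ξ)
    (g : 𝒳 × 𝒜 × Ξ → ℝ) :
    ∑ t : 𝒳 × 𝒜 × Ξ, P t.1 * π₀ t.1 t.2.1 * R t.1 t.2.1 t.2.2 * g t =
      ∑ x, P x * ∑ a, π₀ x a * ∑ ξ, R x a ξ * g (x, a, ξ) := by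
  simp only [Fintype.sum_prod_type, Finset.mul_sum, mul_assoc]

theorem law_mem_stdSimplex {𝒳 𝒜 Ξ : Type*} [Fintype 𝒳] [Fintype 𝒜] [Fintype Ξ]
    (P : stdSimplex ℝ 𝒳) (π₀ : 𝒳 → stdSimplex ℝ 𝒜) (R : 𝒳 → 𝒜 → stdSimplex ℝ Ξ) :
    (fun t : 𝒳 × 𝒜 × Ξ => P t.1 * π₀ t.1 t.2.1 * R t.1 t.2.1 t.2.2) ∈
      stdSimplex ℝ (𝒳 × 𝒜 × Ξ) := by
  refine ⟨fun t => mul_nonneg (mul_nonneg (P.2.1 _) ((π₀ _).2.1 _)) ((R _ _).2.1 _), ?_⟩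
  simpa using sum_law_mul P π₀ R fun _ => 1

theorem measureReal_context_deviation (hD : IsLoggedDataset μ P π₀ R D) (hn : 0 < n)
    (T : Finset 𝒳) {c : ℝ} (hc : 0 ≤ c) :
    μ.real {ω | √(c / (2 * n)) < ∑ x ∈ T, empContext (fun i => D i ω) x - ∑ x ∈ T, P x}
      ≤ Real.exp (-c) := by
  classical
  have hn' : (0 : ℝ) < n := by exact_mod_cast hn
  set s := √(c / (2 * n)) with hs
  have hs2 : 2 * n * s ^ 2 = c := by
    rw [hs, Real.sq_sqrt (by positivity)]
    field_simp
  have hs0 : 0 ≤ s := Real.sqrt_nonneg _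
  -- The tilt 4 * s optimizes Hoeffding: the gain 4ns² exceeds the cost n(4s)²/8 = 2ns² by exactly
  -- c.
  refine (measureReal_mono ?_).trans (measureReal_hoeffding hD.measurable hD.indep
    (fun i t => hD.law i t.1 t.2.1 t.2.2) (law_mem_stdSimplex P π₀ R)
    (h := fun t => if t.1 ∈ T then 1 else 0) (fun t => by split_ifs <;> simp) (4 * s) c)
  intro ω hω
  simp only [Set.mem_ofPred_eq, sum_empContext] at hω ⊢
  have hmean : ∑ t : 𝒳 × 𝒜 × Ξ, P t.1 * π₀ t.1 t.2.1 * R t.1 t.2.1 t.2.2 *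
      (if t.1 ∈ T then (1 : ℝ) else 0) = ∑ x ∈ T, P x := by
    rw [sum_law_mul P π₀ R fun t => if t.1 ∈ T then (1 : ℝ) else 0]
    simp
  rw [hmean]
  rw [lt_sub_iff_add_lt, lt_div_iff₀ hn'] at hω
  have := mul_le_mul_of_nonneg_left hω.le hs0
  nlinarith

theorem measureReal_pairCount_lt (hD : IsLoggedDataset μ P π₀ R D) (x : 𝒳) (a : 𝒜) :
    μ.real {ω | (pairCount (fun i => D i ω) x a : ℝ) < n * (P x * π₀ x a) / 2}
      ≤ Real.exp (-(n * (P x * π₀ x a) ^ 2 / 2)) := by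
  classical
  have hq : 0 ≤ P x * π₀ x a := mul_nonneg (P.2.1 _) ((π₀ _).2.1 _)
  -- Lower tail, hence a negative tilt; for a deviation of q/2 below the mean q = P x * π₀ x a the
  -- optimal one is -4(q/2).
  refine (measureReal_mono ?_).trans (measureReal_hoeffding hD.measurable hD.indep
    (fun i t => hD.law i t.1 t.2.1 t.2.2) (law_mem_stdSimplex P π₀ R)
    (h := fun t => if t.1 = x ∧ t.2.1 = a then 1 else 0) (fun t => by split_ifs <;> simp)
    (-2 * (P x * π₀ x a)) (n * (P x * π₀ x a) ^ 2 / 2))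
  intro ω hω
  simp only [Set.mem_ofPred_eq, pairCount_eq_sum] at hω ⊢
  have hmean : ∑ t : 𝒳 × 𝒜 × Ξ, P t.1 * π₀ t.1 t.2.1 * R t.1 t.2.1 t.2.2 *
      (if t.1 = x ∧ t.2.1 = a then (1 : ℝ) else 0) = P x * π₀ x a := by
    rw [sum_law_mul P π₀ R fun t => if t.1 = x ∧ t.2.1 = a then (1 : ℝ) else 0]
    simp [ite_and]
  rw [hmean]
  have := mul_le_mul_of_nonneg_left hω.le hq
  nlinarith

/-- Given the context and action of a record, exp of the weight w has mean at most 1: by Hoeffding's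
lemma on the pair (x, a), trivially off it, where w = 0. With N the pair count, the event forces the
sum of w to be at least 4s²N - 2s²N ≥ 2s²m = c, so all counts N ≥ m are covered at once. -/
theorem measureReal_outcome_deviation (hD : IsLoggedDataset μ P π₀ R D) (x : 𝒳) (a : 𝒜)
    (T : Finset Ξ) {m c : ℝ} (hm : 0 < m) (hc : 0 ≤ c) :
    μ.real {ω | m ≤ pairCount (fun i => D i ω) x a ∧
      √(c / (2 * m)) < ∑ ξ ∈ T, empOutcome (fun i => D i ω) x a ξ - ∑ ξ ∈ T, R x a ξ}
      ≤ Real.exp (-c) := by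
  classical
  set s := √(c / (2 * m)) with hs
  have hs2 : 2 * m * s ^ 2 = c := by
    rw [hs, Real.sq_sqrt (by positivity)]
    field_simp
  have hs0 : 0 ≤ s := Real.sqrt_nonneg _
  set ρ := ∑ ξ ∈ T, R x a ξ with hρ
  let w : 𝒳 × 𝒜 × Ξ → ℝ := fun t =>
    4 * s * (if (t.1 = x ∧ t.2.1 = a) ∧ t.2.2 ∈ T then 1 else 0)
      - (4 * s * ρ + (4 * s) ^ 2 / 8) * (if t.1 = x ∧ t.2.1 = a then 1 else 0)
  have hw : ∑ t : 𝒳 × 𝒜 × Ξ, P t.1 * π₀ t.1 t.2.1 * R t.1 t.2.1 t.2.2 * Real.exp (w t) ≤ 1 := by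
    have h1 : ∀ x' a', ∑ ξ, R x' a' ξ * Real.exp (w (x', a', ξ)) ≤ 1 := by
      intro x' a'
      by_cases h : x' = x ∧ a' = a
      · obtain ⟨rfl, rfl⟩ := h
        refine le_trans (le_of_eq ?_) (sum_mul_exp_le (R x' a').2
          (h := fun ξ => if ξ ∈ T then 1 else 0) (fun ξ => by split_ifs <;> simp) (4 * s))
        refine Finset.sum_congr rfl fun ξ _ => ?_
        have hmean : ∑ ξ, (R x' a').1 ξ * (if ξ ∈ T then (1 : ℝ) else 0) = ρ := by
          simp only [mul_ite, mul_one, mul_zero, Finset.sum_ite_mem, Finset.univ_inter, hρ]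
          rfl
        rw [hmean]
        simp only [w, and_self, true_and, if_true]
        congr 2
        ring
      · simp [w, h]
    rw [sum_law_mul P π₀ R fun t => Real.exp (w t)]
    calc ∑ x, P x * ∑ a, π₀ x a * ∑ ξ, R x a ξ * Real.exp (w (x, a, ξ))
        ≤ ∑ x, P x * ∑ a, π₀ x a * 1 :=
          Finset.sum_le_sum fun x _ => mul_le_mul_of_nonneg_left
            (Finset.sum_le_sum fun a _ => mul_le_mul_of_nonneg_left (h1 x a) ((π₀ x).2.1 a))
            (P.2.1 x)
      _ = 1 := by simp
  refine (measureReal_mono ?_).trans (measureReal_sum_ge_le_exp_neg hD.measurable hD.indep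
    (fun i t => hD.law i t.1 t.2.1 t.2.2) hw c)
  rintro ω ⟨hN, hω⟩
  have hN0 : (0 : ℝ) < pairCount (fun i => D i ω) x a := hm.trans_le hN
  simp only [Set.mem_ofPred_eq, w, Finset.sum_sub_distrib, ← Finset.mul_sum]
  rw [← pairCount_eq_sum (fun i => D i ω) x a]
  rw [sum_empOutcome, lt_sub_iff_add_lt, lt_div_iff₀ hN0] at hω
  have h1 := mul_le_mul_of_nonneg_left hω.le hs0
  have h2 := mul_le_mul_of_nonneg_right hN (sq_nonneg s)
  nlinarith

end Concentration

/-! ### Numerical bounds and the final union bound -/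

/-- The term k log 2 in the exponent pays for a union bound over the 2^k subsets of a k-point set.
-/
theorem two_pow_mul_exp_neg (k : ℕ) {b : ℝ} (hb : 0 < b) :
    (2 : ℝ) ^ k * Real.exp (-(k * Real.log 2 + Real.log b)) = b⁻¹ := by
  rw [neg_add, Real.exp_add, Real.exp_neg, Real.exp_neg, Real.exp_log hb, Real.exp_nat_mul,
    Real.exp_log two_pos, ← mul_assoc, mul_inv_cancel₀ (by positivity), one_mul]

/-- Subadditivity of the square root, with log 2 ≤ 1 ≤ 2a and 1 ≤ 2b. -/
theorem sqrt_card_add_log_le {k L m a b : ℝ} (hk : 0 ≤ k) (hL : 0 ≤ L) (hm : 0 < m)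
    (ha : 1 / 2 ≤ a) (hb : 1 / 2 ≤ b) :
    √((k * Real.log 2 + L) / (2 * m)) ≤ √(b * L / m) + √(a * k / m) := by
  have hlog : Real.log 2 ≤ 1 := by linarith [Real.log_two_lt_d9]
  have h : (k * Real.log 2 + L) / (2 * m) ≤ b * L / m + a * k / m := by
    rw [← add_div, div_le_div_iff₀ (by positivity) hm]
    have h1 : k * Real.log 2 ≤ k * (2 * a) := mul_le_mul_of_nonneg_left (by linarith) hk
    have h2 : L * 1 ≤ L * (2 * b) := mul_le_mul_of_nonneg_left (by linarith) hL
    nlinarith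
  have hu : 0 ≤ b * L / m := div_nonneg (mul_nonneg (by linarith) hL) hm.le
  have hv : 0 ≤ a * k / m := div_nonneg (mul_nonneg (by linarith) hk) hm.le
  refine Real.sqrt_le_iff.2 ⟨by positivity, h.trans ?_⟩
  rw [add_sq, Real.sq_sqrt hu, Real.sq_sqrt hv]
  have : 0 ≤ 2 * √(b * L / m) * √(a * k / m) := by positivity
  linarith

end WassersteinOPL

theorem mainTheorem2
    {d d' : ℕ} (𝒳 : Finset (EuclideanSpace ℝ (Fin d))) (Ξ : Finset (EuclideanSpace ℝ (Fin d')))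
    {𝒜 : Type*} [Fintype 𝒜] [MeasurableSpace 𝒜] [MeasurableSingletonClass 𝒜]
    (P : stdSimplex ℝ 𝒳) (π₀ : 𝒳 → stdSimplex ℝ 𝒜) (R : 𝒳 → 𝒜 → stdSimplex ℝ Ξ)
    (y : 𝒳 → 𝒜 → Ξ → ℝ)
    (Ymax μπ μx εx εc δ : ℝ)
    (hμπ : 0 < μπ) (hπ₀ : ∀ x a, μπ ≤ π₀ x a)
    (hμx : 0 < μx) (hP : ∀ x, μx ≤ P x)
    (hy : ∀ x a ξ, 0 ≤ y x a ξ ∧ y x a ξ ≤ Ymax)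
    (hεx : 0 < εx) (hεc : 0 < εc) (hδ : 0 < δ) (hδ' : δ < 1)
    {Ω : Type*} [MeasurableSpace Ω] (μ : Measure Ω) [IsProbabilityMeasure μ]
    (n : ℕ) (D : Fin n → Ω → 𝒳 × 𝒜 × Ξ)
    (hD : WassersteinOPL.IsLoggedDataset μ P π₀ R D)
    (hn : 2 * Real.log (4 * 𝒳.card * Fintype.card 𝒜 / δ) / (μπ * μx) ^ 2 ≤ n)
    (Pol : Set (𝒳 → stdSimplex ℝ 𝒜)) (hPol : Pol.Nonempty) :
    1 - δ ≤ μ.real {ω |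
      (∀ x a, 0 < WassersteinOPL.pairCount (fun i => D i ω) x a) ∧
      |(⨅ π : Pol, WassersteinOPL.empRobustValue εx εc (fun i => D i ω) y π)
          - ⨅ π : Pol, WassersteinOPL.robustValue εx εc P R y π|
        ≤ Ymax * (√(2 * Real.log (2 / δ) / n) + √(𝒳.card / n)
            + √(4 * Real.log (4 * 𝒳.card * Fintype.card 𝒜 / δ) / (n * μπ * μx))
            + √(2 * Ξ.card / (n * μπ * μx)))} := by
  classical
  have hX : Nonempty 𝒳 := by
    by_contra h
    rw [not_nonempty_iff] at h
    simpa using stdSimplex.sum_eq_one P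
  obtain ⟨x₀⟩ := id hX
  have hA : Nonempty 𝒜 := by
    by_contra h
    rw [not_nonempty_iff] at h
    simpa using stdSimplex.sum_eq_one (π₀ x₀)
  obtain ⟨a₀⟩ := id hA
  have hΞ : Nonempty Ξ := by
    by_contra h
    rw [not_nonempty_iff] at h
    simpa using stdSimplex.sum_eq_one (R x₀ a₀)
  have hy' : ∀ x a ξ, y x a ξ ∈ Set.Icc 0 Ymax := hy
  have hYmax : 0 ≤ Ymax := (hy x₀ a₀ (Classical.arbitrary Ξ)).1.trans (hy _ _ _).2
  set N : ℝ := 𝒳.card * Fintype.card 𝒜 with hN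
  have hXc : (1 : ℝ) ≤ 𝒳.card := by
    have := Fintype.card_pos (α := 𝒳)
    rw [Fintype.card_coe] at this
    exact_mod_cast this
  have hAc : (1 : ℝ) ≤ Fintype.card 𝒜 := by exact_mod_cast Fintype.card_pos (α := 𝒜)
  have hN1 : 1 ≤ N := one_le_mul_of_one_le_of_one_le hXc hAc
  rw [mul_assoc 4 (𝒳.card : ℝ)] at hn ⊢
  rw [← hN] at hn ⊢
  set L := Real.log (4 * N / δ) with hL
  have hb : 1 < 4 * N / δ := by
    rw [lt_div_iff₀ hδ]
    linarith
  have hb0 : 0 < 4 * N / δ := one_pos.trans hb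
  have hL0 : 0 < L := Real.log_pos hb
  have hL1 : 0 < Real.log (2 / δ) := Real.log_pos (by rw [lt_div_iff₀ hδ]; linarith)
  have hμ : 0 < μπ * μx := mul_pos hμπ hμx
  have hn0 : (0 : ℝ) < n := lt_of_lt_of_le (by positivity) hn
  have hn0' : 0 < n := by exact_mod_cast hn0
  -- Half the guaranteed expected count of any pair; outside B₂ every count reaches it.
  set m : ℝ := n * μπ * μx / 2 with hm
  have hm0 : 0 < m := by positivity
  -- The exponents are tuned so that, after the union bounds, B₁ has probability at most δ/2 and B₃
  -- at most δ/4; B₂ takes the remaining δ/4.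
  set c₁ : ℝ := 𝒳.card * Real.log 2 + Real.log (2 / δ) with hc₁
  set c₂ : ℝ := Ξ.card * Real.log 2 + L with hc₂
  have hlog2 : 0 < Real.log 2 := Real.log_pos one_lt_two
  have hc₁0 : 0 ≤ c₁ := by positivity
  have hc₂0 : 0 ≤ c₂ := by positivity
  set s := √(c₁ / (2 * n)) with hs
  set t := √(c₂ / (2 * m)) with ht
  let B₁ : Set Ω := ⋃ T : Finset 𝒳,
    {ω | s < ∑ x ∈ T, WassersteinOPL.empContext (fun i => D i ω) x - ∑ x ∈ T, P x}
  let B₂ : Set Ω := ⋃ p : 𝒳 × 𝒜,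
    {ω | (WassersteinOPL.pairCount (fun i => D i ω) p.1 p.2 : ℝ) < n * (P p.1 * π₀ p.1 p.2) / 2}
  let B₃ : Set Ω := ⋃ p : (𝒳 × 𝒜) × Finset Ξ,
    {ω | m ≤ WassersteinOPL.pairCount (fun i => D i ω) p.1.1 p.1.2 ∧
      t < ∑ ξ ∈ p.2, WassersteinOPL.empOutcome (fun i => D i ω) p.1.1 p.1.2 ξ
        - ∑ ξ ∈ p.2, R p.1.1 p.1.2 ξ}
  have hB₁ : μ.real B₁ ≤ δ / 2 := by
    refine (measureReal_iUnion_fintype_le _).trans ((Finset.sum_le_sum fun T _ =>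
      WassersteinOPL.measureReal_context_deviation hD hn0' T hc₁0).trans (le_of_eq ?_))
    rw [Finset.sum_const, Finset.card_univ, Fintype.card_finset, Fintype.card_coe, nsmul_eq_mul]
    push_cast
    rw [hc₁, WassersteinOPL.two_pow_mul_exp_neg _ (by positivity), inv_div]
  have hpair : ∀ x a, μπ * μx ≤ P x * π₀ x a := fun x a => by
    rw [mul_comm]
    exact mul_le_mul (hP x) (hπ₀ x a) hμπ.le (hμx.le.trans (hP x))
  have hcard : ((Fintype.card (𝒳 × 𝒜) : ℕ) : ℝ) = N := by
    rw [Fintype.card_prod, Fintype.card_coe]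
    push_cast
    rfl
  have hB₂ : μ.real B₂ ≤ δ / 4 := by
    have h1 : ∀ p : 𝒳 × 𝒜, μ.real {ω | (WassersteinOPL.pairCount (fun i => D i ω) p.1 p.2 : ℝ)
        < n * (P p.1 * π₀ p.1 p.2) / 2} ≤ (4 * N / δ)⁻¹ := fun p => by
      refine (WassersteinOPL.measureReal_pairCount_lt hD p.1 p.2).trans ?_
      rw [← Real.exp_log hb0, ← Real.exp_neg, Real.exp_le_exp, neg_le_neg_iff, ← hL]
      have h2 : (μπ * μx) ^ 2 ≤ (P p.1 * π₀ p.1 p.2) ^ 2 :=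
        pow_le_pow_left₀ hμ.le (hpair _ _) 2
      -- The sample size condition says exactly that L ≤ n (μπ μx)² / 2.
      rw [div_le_iff₀ (by positivity)] at hn
      have h3 := mul_le_mul_of_nonneg_left h2 hn0.le
      linarith
    refine (measureReal_iUnion_fintype_le _).trans
      ((Finset.sum_le_sum fun p _ => h1 p).trans (le_of_eq ?_))
    rw [Finset.sum_const, Finset.card_univ, nsmul_eq_mul, hcard]
    field_simp
  have hB₃ : μ.real B₃ ≤ δ / 4 := by
    refine (measureReal_iUnion_fintype_le _).trans ((Finset.sum_le_sum fun p _ =>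
      WassersteinOPL.measureReal_outcome_deviation hD p.1.1 p.1.2 p.2 hm0 hc₂0).trans
      (le_of_eq ?_))
    rw [Finset.sum_const, Finset.card_univ, Fintype.card_prod, Fintype.card_finset,
      Fintype.card_coe, nsmul_eq_mul]
    push_cast
    rw [hcard, mul_assoc, hc₂, WassersteinOPL.two_pow_mul_exp_neg _ hb0]
    field_simp
  set G : Set Ω := {ω | (∀ x a, 0 < WassersteinOPL.pairCount (fun i => D i ω) x a) ∧ _} with hG
  -- Covering the whole space and using subadditivity avoids complements, hence any measurability of
  -- G.
  have hcover : Set.univ ⊆ G ∪ (B₁ ∪ (B₂ ∪ B₃)) := by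
    intro ω _
    by_contra hω
    simp only [Set.mem_union, not_or, B₁, B₂, B₃, Set.mem_iUnion, not_exists,
      Set.mem_ofPred_eq, not_lt, not_and] at hω
    obtain ⟨hωG, h1, h2, h3⟩ := hω
    have hcount : ∀ x a, m ≤ WassersteinOPL.pairCount (fun i => D i ω) x a := fun x a => by
      refine le_trans ?_ (h2 (x, a))
      have := mul_le_mul_of_nonneg_left (hpair x a) hn0.le
      rw [hm]
      linarith
    have hcount' : ∀ x a, 0 < WassersteinOPL.pairCount (fun i => D i ω) x a := fun x a => by
      exact_mod_cast hm0.trans_le (hcount x a)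
    refine hωG ⟨hcount', ?_⟩
    refine (WassersteinOPL.abs_iInf_empRobustValue_sub_le hεx hεc P R hy' hPol hn0' hcount' h1
      fun x a T => h3 ((x, a), T) (hcount x a)).trans
      (mul_le_mul_of_nonneg_left ?_ hYmax)
    have hs' : s ≤ √(2 * Real.log (2 / δ) / n) + √(1 * 𝒳.card / n) :=
      WassersteinOPL.sqrt_card_add_log_le (by positivity) hL1.le hn0 (by norm_num) (by norm_num)
    have ht' : t ≤ √(2 * L / m) + √(1 * Ξ.card / m) :=
      WassersteinOPL.sqrt_card_add_log_le (by positivity) hL0.le hm0 (by norm_num) (by norm_num)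
    have e1 : 2 * L / m = 4 * L / (n * μπ * μx) := by rw [hm]; field_simp; norm_num
    have e2 : 1 * (Ξ.card : ℝ) / m = 2 * Ξ.card / (n * μπ * μx) := by rw [hm]; field_simp
    rw [e1, e2] at ht'
    rw [one_mul] at hs'
    linarith
  have htotal : 1 ≤ μ.real G + (μ.real B₁ + (μ.real B₂ + μ.real B₃)) := by
    calc (1 : ℝ) = μ.real Set.univ := by simp
      _ ≤ μ.real (G ∪ (B₁ ∪ (B₂ ∪ B₃))) := measureReal_mono hcover
      _ ≤ _ := (measureReal_union_le _ _).trans (add_le_add_right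
          ((measureReal_union_le _ _).trans (add_le_add_right (measureReal_union_le _ _) _)) _)
  linarith
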